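/- Let $n\ge 1$, $r\ge 1$. A flag in $\mathbb{R}^n$ is a tuple $F_0\subseteq F_1\subseteq\cdots\subseteq F_n$ of linear subspaces of $\mathbb{R}^n$ with $\dim F_k=k$; let $\mathrm{Flag}(n)$ be the flag manifold of all flags. Let $\omega_k$ be the volume of the unit ball of $\mathbb{R}^k$, $[k]_{\mathbb{R}}=\frac{k\,\omega_k}{2\,\omega_{k-1}}$ for $k\ge1$, $[k]_{\mathbb{R}}!=[k]_{\mathbb{R}}[k-1]_{\mathbb{R}}\cdots[1]_{\mathbb{R}}$, and let $\phi_n$ be the unique $O(n)$-invariant Borel measure on $\mathrm{Flag}(n)$ of total mass $[n]_{\mathbb{R}}!$. An $r$-decomposition of $\mathbb{R}^n$ is a tuple $(D_1,\ldots,D_r)$ of nonzero, pairwise orthogonal subspaces with $D_1\oplus\cdots\oplus D_r=\mathbb{R}^n$. For a family $\mathcal{D}$ of $r$-decompositions and positive integers $a_1,\ldots,a_r$ with $a_1+\cdots+a_r=n$, let $\mathcal{D}_{a_1,\ldots,a_r}$ be the set of all $(D_1,\ldots,D_r)\in\mathcal{D}$ with $\dim D_i=a_i$ for all $i$, and let $\mathcal{D}_k=\{D_k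 : (D_1,\ldots,D_r)\in\mathcal{D}\}$. Put $$\nu^n_{a_1,\ldots,a_r}(\mathcal{D}_{a_1,\ldots,a_r})=\frac{\phi_n\big(\mathrm{Flag}(\mathcal{D}_{a_1,\ldots,a_r})\big)}{[a_1]_{\mathbb{R}}!\cdots[a_r]_{\mathbb{R}}!},$$ where $\mathrm{Flag}(\mathcal{D}_{a_1,\ldots,a_r})$ is the set of all flags $(F_0,\ldots,F_n)$ for which some $(D_1,\ldots,D_r)\in\mathcal{D}_{a_1,\ldots,a_r}$ satisfies $F_{a_1+\cdots+a_i}=D_1\oplus\cdots\oplus D_i$ for all $i$. The multiflag coefficient $\genfrac{[}{]}{0pt}{}{n}{a_1,\ldots,a_r}_{\mathbb{R}}$ is the value of $\nu^n_{a_1,\ldots,a_r}$ on the set of all $r$-decompositions with $\dim D_i=a_i$ for all $i$, and $\nu_{n;r}(\mathcal{D})=\sum_{a_1+\cdots+a_r=n}\nu^n_{a_1,\ldots,a_r}(\mathcal{D}_{a_1,\ldots,a_r})$. All sums are over positive integers $a_1,\ldots,a_r$. A set of subspaces is $t$-chain free if it does not contain $t+1$ distinct, pairwise comparable (under inclusion)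 subspaces. **Theorem.** Let $t_1,\ldots,t_r$ be positive integers and $\sigma=\frac{t_1t_2\cdots t_r}{\max\{t_1,\ldots,t_r\}}$. Let $\mathcal{D}$ be a family of $r$-decompositions of $\mathbb{R}^n$, each part $\mathcal{D}_{a_1,\ldots,a_r}$ of which is measurable, such that $\mathcal{D}_k$ is $t_k$-chain free for each $k\in\{1,\ldots,r\}$. Then $$\sum_{a_1+\cdots+a_r=n}\frac{\nu^n_{a_1,\ldots,a_r}(\mathcal{D}_{a_1,\ldots,a_r})}{\genfrac{[}{]}{0pt}{}{n}{a_1,\ldots,a_r}_{\mathbb{R}}}\le\sigma.$$ Consequently, $\nu_{n;r}(\mathcal{D})\le m_1+\cdots+m_\sigma$, where $m_1,\ldots,m_\sigma$ are the $\sigma$ largest multiflag coefficients $\genfrac{[}{]}{0pt}{}{n}{a_1,\ldots,a_r}_{\mathbb{R}}$ (one for each tuple of positive integers $a_1,\ldots,a_r$ with $a_1+\cdots+a_r=n$, counted with multiplicity; $m_i=0$ if $i$ exceeds the number $\binom{n-1}{r-1}$ of these tuples). -/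

import Mathlib

open MeasureTheory Set
open scoped ENNReal

noncomputable section

namespace ContinuousLYM

/-! ### Subspaces and flags of `ℝⁿ` -/

/-- The Euclidean space `ℝⁿ`. -/
abbrev E (n : ℕ) : Type := EuclideanSpace ℝ (Fin n)

/-- `Mod(n)`: the lattice of linear subspaces of `ℝⁿ`. -/
abbrev ModR (n : ℕ) : Type := Submodule ℝ (E n)

/-- `Flag(n)`: tuples `F₀ ⊆ F₁ ⊆ ⋯ ⊆ Fₙ` of subspaces of `ℝⁿ` with `dim F_k = k`. -/
def Flag (n : ℕ) : Type :=
  {F : Fin (n + 1) → ModR n // (∀ k, Module.finrank ℝ (F k) = (k : ℕ)) ∧ Monotone F}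

/-- The usual topology of the flag manifold: a subspace is identified with the orthogonal
projection onto it, and a flag with the tuple of its projections. -/
instance (n : ℕ) : TopologicalSpace (Flag n) :=
  TopologicalSpace.induced
    (fun F : Flag n => fun k : Fin (n + 1) => (F.1 k).starProjection) inferInstance

/-- `Flag(n)` carries its Borel σ-algebra. -/
instance (n : ℕ) : MeasurableSpace (Flag n) := borel _

instance (n : ℕ) : BorelSpace (Flag n) := ⟨rfl⟩

/-! ### The orthogonal group and its action on flags -/

/-- The orthogonal group `O(n)`: the linear operators `g` on `ℝⁿ` with `g* g = g g* = 1`. -/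
abbrev OrthGroup (n : ℕ) : Type := unitary (E n →L[ℝ] E n)

instance (n : ℕ) : ContinuousStar (E n →L[ℝ] E n) :=
  ⟨(ContinuousLinearMap.adjoint : (E n →L[ℝ] E n) ≃ₗᵢ⋆[ℝ] (E n →L[ℝ] E n)).continuous⟩

instance (n : ℕ) : IsTopologicalGroup (OrthGroup n) := inferInstance

instance (n : ℕ) : CompactSpace (OrthGroup n) := by
  have : ProperSpace (E n →L[ℝ] E n) := FiniteDimensional.proper ℝ _
  refine isCompact_iff_compactSpace.mp (Metric.isCompact_of_isClosed_isBounded ?_ ?_)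
  · exact isClosed_unitary
  · refine (Metric.isBounded_closedBall (x := (0 : E n →L[ℝ] E n)) (r := 1)).subset ?_
    intro g hg
    rw [mem_closedBall_zero_iff]
    refine ContinuousLinearMap.opNorm_le_bound _ zero_le_one fun x => ?_
    have h := (Unitary.linearIsometryEquiv (⟨g, hg⟩ : OrthGroup n)).norm_map x
    rw [one_mul]
    exact h.le

/-- The action of `O(n)` on `Flag(n)`: `g • (F₀, …, Fₙ) = (g F₀, …, g Fₙ)`. -/
instance (n : ℕ) : SMul (OrthGroup n) (Flag n) where
  smul g F :=
    ⟨fun k => (F.1 k).map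
        ((Unitary.linearIsometryEquiv g).toLinearEquiv : E n →ₗ[ℝ] E n),
      fun k => by rw [LinearEquiv.finrank_map_eq]; exact F.2.1 k,
      fun _ _ h => Submodule.map_mono (F.2.2 h)⟩

/-- The standard flag, with `F_k` spanned by the first `k` vectors of the standard basis. -/
def stdFlag (n : ℕ) : Flag n :=
  ⟨fun k => Submodule.span ℝ
      (Set.range fun j : {j : Fin n // (j : ℕ) < k} => EuclideanSpace.basisFun (Fin n) ℝ j.1),
    fun k => by
      have h : LinearIndependent ℝ
          (fun j : {j : Fin n // (j : ℕ) < k} => EuclideanSpace.basisFun (Fin n) ℝ j.1) :=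
        (EuclideanSpace.basisFun (Fin n) ℝ).orthonormal.linearIndependent.comp _
          Subtype.val_injective
      rw [finrank_span_eq_card h, Fintype.card_subtype, Fin.card_filter_val_lt]
      exact min_eq_right (Nat.lt_succ_iff.mp k.2),
    fun k l hkl => Submodule.span_mono (by
      rintro _ ⟨j, rfl⟩
      exact ⟨⟨j.1, lt_of_lt_of_le j.2 hkl⟩, rfl⟩)⟩

/-- The orbit map of the standard flag is continuous, hence Borel measurable. -/
theorem continuous_orbit (n : ℕ) :
    Continuous fun g : OrthGroup n => g • stdFlag n := by
  refine continuous_induced_rng.2 (continuous_pi fun k => ?_)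
  have h : ∀ g : OrthGroup n, ((g • stdFlag n).1 k).starProjection
      = (g : E n →L[ℝ] E n) * ((stdFlag n).1 k).starProjection
        * ((g⁻¹ : OrthGroup n) : E n →L[ℝ] E n) := by
    intro g
    ext1 x
    exact Submodule.starProjection_map_apply (Unitary.linearIsometryEquiv g) _ x
  simp only [Function.comp_def, h]
  exact (continuous_subtype_val.mul continuous_const).mul
    (continuous_subtype_val.comp continuous_inv)

/-! ### The invariant measures -/

/-- `ω_k`: the volume of the unit ball of `ℝᵏ`. -/
def omega (k : ℕ) : ℝ := (volume (Metric.ball (0 : E k) 1)).toReal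

/-- `[k]_ℝ = k ω_k / (2 ω_{k-1})`, for `k ≥ 1`. -/
def bracket (k : ℕ) : ℝ := k * omega k / (2 * omega (k - 1))

/-- `[k]_ℝ! = [k]_ℝ [k-1]_ℝ ⋯ [1]_ℝ`. -/
def bracketFactorial (k : ℕ) : ℝ := ∏ i ∈ Finset.Icc 1 k, bracket i

/-- `φ_n`: the `O(n)`-invariant Borel measure on `Flag(n)` of total mass `[n]_ℝ!`.
As `O(n)` acts transitively on `Flag(n)`, it is the image of the Haar measure of `O(n)` under
an orbit map, where the Haar measure is scaled to have total mass `[n]_ℝ!`. -/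
def flagMeasure (n : ℕ) : Measure (Flag n) :=
  ENNReal.ofReal (bracketFactorial n) •
    Measure.map (fun g : OrthGroup n => g • stdFlag n) (Measure.haarMeasure ⊤)

/-! ### Orthogonal decompositions -/

/-- `(D₁, …, D_r)` is an `r`-decomposition of `ℝⁿ`: the `D_i` are nonzero and pairwise
orthogonal, and `ℝⁿ` is their direct sum. -/
def IsDecomposition {n r : ℕ} (D : Fin r → ModR n) : Prop :=
  (∀ i, D i ≠ ⊥) ∧ (∀ i j, i ≠ j → D i ⟂ D j) ∧ DirectSum.IsInternal D

/-- `𝒟(ℝⁿ, r)`: the set of all `r`-decompositions of `ℝⁿ`. -/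
def decompositions (n r : ℕ) : Set (Fin r → ModR n) := {D | IsDecomposition D}

/-- The tuples `(a₁, …, a_r)` of positive integers with `a₁ + ⋯ + a_r = n`. -/
def compositions (n r : ℕ) : Finset (Fin r → ℕ) :=
  (Finset.piAntidiag Finset.univ n).filter fun a => ∀ i, 0 < a i

/-- `𝒟_{a₁, …, a_r}`: the members of `𝒟` with `dim D_i = a_i` for all `i`. -/
def ofType {n r : ℕ} (𝒟 : Set (Fin r → ModR n)) (a : Fin r → ℕ) : Set (Fin r → ModR n) :=
  {D ∈ 𝒟 | ∀ i, Module.finrank ℝ (D i) = a i}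

/-- `𝒟_k`: the set of the `k`-th components of the members of `𝒟`. -/
def component {n r : ℕ} (𝒟 : Set (Fin r → ModR n)) (k : Fin r) : Set (ModR n) :=
  {V | ∃ D ∈ 𝒟, D k = V}

/-- `𝒜` is `t`-chain free: it contains no `t + 1` distinct, pairwise comparable subspaces. -/
def ChainFree {n : ℕ} (t : ℕ) (𝒜 : Set (ModR n)) : Prop :=
  ¬ ∃ C : Finset (ModR n), (C : Set (ModR n)) ⊆ 𝒜 ∧ IsChain (· ≤ ·) (C : Set (ModR n)) ∧
    C.card = t + 1

/-- The flag `F` is compatible with `(D₁, …, D_r)` of dimensions `a₁, …, a_r`: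
`F_{a₁ + ⋯ + a_i} = D₁ ⊕ ⋯ ⊕ D_i` for all `i`. -/
def Compatible {n r : ℕ} (F : Flag n) (D : Fin r → ModR n) : Prop :=
  ∀ i : Fin r, ∃ k : Fin (n + 1),
    (k : ℕ) = ∑ j ∈ Finset.Iic i, Module.finrank ℝ (D j) ∧
      F.1 k = ⨆ j ∈ Finset.Iic i, D j

/-- `Flag(𝒟)`: the set of all flags compatible with some member of `𝒟`. -/
def flagsOf {n r : ℕ} (𝒟 : Set (Fin r → ModR n)) : Set (Flag n) :=
  {F | ∃ D ∈ 𝒟, Compatible F D}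

/-- `ν_{a₁, …, a_r}^n`, the measure on `𝒟(ℝⁿ, r)_{a₁, …, a_r}` induced by `φ_n`:
`ν(𝒟) = φ_n(Flag(𝒟)) / ([a₁]_ℝ! ⋯ [a_r]_ℝ!)`. -/
def nuType (n : ℕ) {r : ℕ} (a : Fin r → ℕ) (𝒟 : Set (Fin r → ModR n)) : ℝ≥0∞ :=
  flagMeasure n (flagsOf 𝒟) / ENNReal.ofReal (∏ i, bracketFactorial (a i))

/-- The multiflag coefficient of `a₁, …, a_r`: the total measure of `𝒟(ℝⁿ, r)_{a₁, …, a_r}`. -/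
def multiflag (n : ℕ) {r : ℕ} (a : Fin r → ℕ) : ℝ≥0∞ :=
  nuType n a (ofType (decompositions n r) a)

/-- `ν_{n;r}`: the measure on `𝒟(ℝⁿ, r)` obtained by adding up the `ν_{a₁, …, a_r}^n`. -/
def nu (n r : ℕ) (𝒟 : Set (Fin r → ModR n)) : ℝ≥0∞ :=
  ∑ a ∈ compositions n r, nuType n a (ofType 𝒟 a)

/-- A family of `r`-decompositions is measurable if each of its parts `𝒟_{a₁, …, a_r}` is
measurable for (the completion of) the measure `ν_{a₁, …, a_r}^n` induced by `φ_n`. -/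
def MeasurableFamily {n r : ℕ} (𝒟 : Set (Fin r → ModR n)) : Prop :=
  ∀ a ∈ compositions n r, NullMeasurableSet (flagsOf (ofType 𝒟 a)) (flagMeasure n)

/-- The sum of the `k` largest entries of a finite multiset, counted with multiplicity (of all
its entries if there are fewer than `k`). -/
def sumLargest (s : Multiset ℝ≥0∞) (k : ℕ) : ℝ≥0∞ :=
  ((s.sort (· ≥ ·)).take k).sum

end ContinuousLYM

end

open ContinuousLYM

noncomputable section

namespace ContinuousLYM

/-! ### Sums of largest entries -/

/-! Pick `g` in `O(n)` at random for Haar measure and view it as a random orthonormal frame. Cutting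
the frame into consecutive blocks of sizes `a` gives one decomposition of each type `a`, and it is
the only one of that type compatible with the flag of `g`. Hence `nuType / multiflag` is the
probability that this block decomposition lies in `𝒟` (`nuType_div_multiflag`), and the sum over `a`
is the expected number of types that `𝒟` catches in a random frame.

Right translation by a permutation matrix preserves Haar measure, so for each type the blocks may be
laid out in any order without changing the probability. Put an index `m` with maximal `t m` last. In
a fixed frame, once the blocks before block `k` have fixed sizes, block `k` has a fixed start, so
its possible spans form a chain and at most `t k` sizes occur. The last size is forced by the total
`n`. So every frame catches at most `∏_{i ≠ m} t i = σ` types (`card_types_le`), and integration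
gives the first bound.

The second bound is a linear optimization: weights in `[0, 1]` of total at most `σ` do best on the
`σ` largest coefficients (`sum_mul_le_sumLargest`). -/

theorem exists_subset_card_eq_forall_le {ι α : Type*} [DecidableEq ι] [LinearOrder α]
    (f : ι → α) (s : Finset ι) (k : ℕ) (hk : k ≤ s.card) :
    ∃ T ⊆ s, T.card = k ∧ ∀ a ∈ T, ∀ b ∈ s \ T, f b ≤ f a := by
  induction k with
  | zero => exact ⟨∅, by simp, by simp, by simp⟩
  | succ k ih =>
    obtain ⟨T, hTs, hT, hle⟩ := ih (by omega)
    have hne : (s \ T).Nonempty := by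
      rw [← Finset.card_pos, Finset.card_sdiff_of_subset hTs]
      omega
    obtain ⟨c, hc, hmax⟩ := Finset.exists_max_image (s \ T) f hne
    have hc' := Finset.mem_sdiff.1 hc
    refine ⟨insert c T, Finset.insert_subset hc'.1 hTs, ?_, fun a ha b hb => ?_⟩
    · rw [Finset.card_insert_of_notMem hc'.2, hT]
    · simp only [Finset.mem_sdiff, Finset.mem_insert, not_or] at hb
      have hb' : b ∈ s \ T := Finset.mem_sdiff.2 ⟨hb.1, hb.2.2⟩
      rcases Finset.mem_insert.1 ha with rfl | ha
      · exact hmax b hb'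
      · exact hle a ha b hb'

theorem sumLargest_of_card_le (s : Multiset ℝ≥0∞) (k : ℕ) (h : s.card ≤ k) :
    sumLargest s k = s.sum := by
  unfold sumLargest
  rw [List.take_of_length_le (by simpa using h), ← Multiset.sum_coe, Multiset.sort_eq]

theorem sumLargest_add (s t : Multiset ℝ≥0∞) (h : ∀ a ∈ s, ∀ b ∈ t, b ≤ a) :
    sumLargest (s + t) s.card = s.sum := by
  have hsort : (s + t).sort (· ≥ ·) = s.sort (· ≥ ·) ++ t.sort (· ≥ ·) := by
    refine List.Perm.eq_of_pairwise (le := (· ≥ ·)) (fun a b _ _ h1 h2 => le_antisymm h2 h1)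
      (Multiset.pairwise_sort _ _) ?_ ?_
    · refine List.pairwise_append.2 ⟨Multiset.pairwise_sort _ _, Multiset.pairwise_sort _ _, ?_⟩
      intro a ha b hb
      exact h a (by simpa using ha) b (by simpa using hb)
    · rw [← Multiset.coe_eq_coe, ← Multiset.coe_add]
      simp only [Multiset.sort_eq]
  unfold sumLargest
  rw [hsort, List.take_left' (by simp), ← Multiset.sum_coe, Multiset.sort_eq]

/-- Exchange argument: let `T` carry the `k` largest values. The weight outside `T` is at most the
weight missing inside `T`, and moving it inside across the threshold `θ` cannot lower the sum. -/
theorem sum_mul_le_sumLargest {ι : Type*} (s : Finset ι) (p M : ι → ℝ≥0∞) (k : ℕ)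
    (hp : ∀ a ∈ s, p a ≤ 1) (hsum : ∑ a ∈ s, p a ≤ k) :
    ∑ a ∈ s, p a * M a ≤ sumLargest (s.val.map M) k := by
  classical
  rcases le_total s.card k with hk | hk
  · rw [sumLargest_of_card_le _ _ (by simpa using hk)]
    exact Finset.sum_le_sum fun a ha => mul_le_of_le_one_left' (hp a ha)
  obtain ⟨T, hTs, rfl, hle⟩ := exists_subset_card_eq_forall_le M s k hk
  have hval : s.val = T.val + (s \ T).val := by
    have h := Finset.disjUnion_val T (s \ T) Finset.disjoint_sdiff
    rw [Finset.disjUnion_eq_union, Finset.union_sdiff_of_subset hTs] at h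
    exact h
  have hlargest : sumLargest (s.val.map M) T.card = ∑ a ∈ T, M a := by
    have h := sumLargest_add (T.val.map M) ((s \ T).val.map M) (by
      intro a ha b hb
      obtain ⟨x, hx, rfl⟩ := Multiset.mem_map.1 ha
      obtain ⟨y, hy, rfl⟩ := Multiset.mem_map.1 hb
      exact hle x hx y hy)
    rw [hval, Multiset.map_add]
    simpa using h
  set θ := (s \ T).sup M with hθ
  have hrest : ∑ a ∈ s \ T, p a ≤ ∑ a ∈ T, (1 - p a) := by
    have hfin : ∑ a ∈ T, p a ≠ ∞ :=
      (ENNReal.sum_lt_top.2 fun a ha => (hp a (hTs ha)).trans_lt ENNReal.one_lt_top).ne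
    refine (ENNReal.add_le_add_iff_right hfin).1 ?_
    rw [Finset.sum_sdiff hTs, ← Finset.sum_add_distrib]
    refine hsum.trans (le_of_eq ?_)
    rw [Finset.sum_congr rfl fun a ha => tsub_add_cancel_of_le (hp a (hTs ha))]
    simp
  rw [hlargest, ← Finset.sum_sdiff hTs]
  calc ∑ a ∈ s \ T, p a * M a + ∑ a ∈ T, p a * M a
      ≤ (∑ a ∈ s \ T, p a) * θ + ∑ a ∈ T, p a * M a := by
        rw [Finset.sum_mul]
        gcongr with a ha
        exact Finset.le_sup ha
    _ ≤ (∑ a ∈ T, (1 - p a)) * θ + ∑ a ∈ T, p a * M a := by gcongr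
    _ ≤ ∑ a ∈ T, (1 - p a) * M a + ∑ a ∈ T, p a * M a := by
        rw [Finset.sum_mul]
        gcongr with a ha
        exact Finset.sup_le fun b hb => hle a ha b hb
    _ = ∑ a ∈ T, M a := by
        rw [← Finset.sum_add_distrib]
        refine Finset.sum_congr rfl fun a ha => ?_
        rw [← add_mul, tsub_add_cancel_of_le (hp a (hTs ha)), one_mul]

/-! ### Counting integer tuples coordinate by coordinate -/

/-- A finite set of tuples has at most `∏ t` elements if, reading the coordinates in the order
given by `τ`, there are at most `t k` choices for coordinate `k` once the earlier ones are fixed. -/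
theorem card_image_restrict_le_prod {ι : Type*} [Fintype ι] [DecidableEq ι] (τ : ι → ℕ)
    (t : ι → ℕ) (S : Finset (ι → ℕ)) (T : Finset ι)
    (hT : ∀ k ∈ T, ∀ l, τ l < τ k → l ∈ T)
    (h : ∀ k ∈ T, ∀ a ∈ S,
      (({b ∈ S | ∀ l, τ l < τ k → b l = a l}).image fun b => b k).card ≤ t k) :
    (S.image fun a i => if i ∈ T then a i else 0).card ≤ ∏ i ∈ T, t i := by
  induction T using Finset.induction_on_max_value τ with
  | empty =>
    simp only [Finset.notMem_empty, if_false, Finset.prod_empty]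
    exact Finset.card_le_one.2 (by simp +contextual)
  | insert m T hm hmax ih =>
    -- The new index `m` is `τ`-maximal, so fixing the coordinates in `T` fixes every coordinate
    -- before `m`.
    have hlow : ∀ l, τ l < τ m → l ∈ T := fun l hl => by
      rcases Finset.mem_insert.1 (hT m (Finset.mem_insert_self _ _) l hl) with rfl | h
      · exact absurd hl (lt_irrefl _)
      · exact h
    have ih' := ih
      (fun k hk l hl => hlow l (hl.trans_le (hmax k hk)))
      (fun k hk => h k (Finset.mem_insert_of_mem hk))
    rw [Finset.prod_insert hm]
    set X := S.image fun a i => if i ∈ insert m T then a i else 0 with hX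
    set f : (ι → ℕ) → (ι → ℕ) := fun a i => if i ∈ T then a i else 0 with hf
    have himg : X.image f = S.image fun a i => if i ∈ T then a i else 0 := by
      rw [hX, Finset.image_image]
      refine Finset.image_congr fun a _ => ?_
      funext i
      by_cases hi : i ∈ T <;> simp [hf, hi]
    rw [← himg] at ih'
    -- Forgetting coordinate `m` has fibres of size at most `t m`, since coordinate `m` is injective
    -- on each fibre.
    refine (Finset.card_le_mul_card_image (f := f) X (t m) fun c hc => ?_).trans
      (Nat.mul_le_mul_left _ ih')
    obtain ⟨x, hx, rfl⟩ := Finset.mem_image.1 hc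
    obtain ⟨a, ha, rfl⟩ := Finset.mem_image.1 hx
    refine le_trans ?_ (h m (Finset.mem_insert_self _ _) a ha)
    refine Finset.card_le_card_of_injOn (fun y => y m) ?_ ?_
    · intro y hy
      obtain ⟨hyX, hy⟩ := Finset.mem_filter.1 hy
      obtain ⟨b, hb, rfl⟩ := Finset.mem_image.1 hyX
      refine Finset.mem_coe.2 (Finset.mem_image.2 ⟨b, Finset.mem_filter.2 ⟨hb, fun l hl => ?_⟩, ?_⟩)
      · have := congrFun hy l
        simpa [hf, hlow l hl] using this
      · simp
    · intro y hy z hz hyz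
      obtain ⟨hyX, hy⟩ := Finset.mem_filter.1 hy
      obtain ⟨hzX, hz⟩ := Finset.mem_filter.1 hz
      obtain ⟨b, hb, rfl⟩ := Finset.mem_image.1 hyX
      obtain ⟨c, hc, rfl⟩ := Finset.mem_image.1 hzX
      funext i
      by_cases hi : i ∈ T
      · simpa [hf, hi] using congrFun (hy.trans hz.symm) i
      · by_cases him : i = m
        · subst him; exact hyz
        · simp [hi, him]

/-- The last coordinate is free if all tuples have the same sum. -/
theorem card_le_prod_erase {ι : Type*} [Fintype ι] [DecidableEq ι] (τ : ι → ℕ)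
    (t : ι → ℕ) (S : Finset (ι → ℕ)) (n : ℕ) (hS : ∀ a ∈ S, ∑ i, a i = n)
    (m : ι) (hm : ∀ k, τ k ≤ τ m)
    (h : ∀ k, k ≠ m → ∀ a ∈ S,
      (({b ∈ S | ∀ l, τ l < τ k → b l = a l}).image fun b => b k).card ≤ t k) :
    S.card ≤ ∏ i ∈ Finset.univ.erase m, t i := by
  refine le_trans (le_of_eq ?_) (card_image_restrict_le_prod τ t S (Finset.univ.erase m)
    (fun k _ l hl => ?_) fun k hk => h k (Finset.ne_of_mem_erase hk))
  · refine (Finset.card_image_of_injOn fun a ha b hb hab => ?_).symm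
    have hne : ∀ i, i ≠ m → a i = b i := fun i hi => by simpa [hi] using congrFun hab i
    funext i
    by_cases hi : i = m
    · subst hi
      have h1 := hS a ha
      have h2 := hS b hb
      rw [← Finset.add_sum_erase _ _ (Finset.mem_univ i)] at h1 h2
      rw [Finset.sum_congr rfl fun j hj => hne j (Finset.ne_of_mem_erase hj)] at h1
      exact Nat.add_right_cancel (h1.trans h2.symm)
    · exact hne i hi
  · refine Finset.mem_erase.2 ⟨?_, Finset.mem_univ _⟩
    rintro rfl
    exact absurd (hm k) (not_le.2 hl)

/-! ### Consecutive blocks of indices -/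

/-- The first index of the block `i`, where blocks of sizes `a` follow each other in the order
given by `τ`. -/
def blockStart {r : ℕ} (τ : Fin r → ℕ) (a : Fin r → ℕ) (i : Fin r) : ℕ :=
  ∑ l with τ l < τ i, a l

/-- The block `i` of `{0, …, n - 1}`, where blocks of sizes `a` follow each other in the order
given by `τ`. -/
def block (n : ℕ) {r : ℕ} (τ : Fin r → ℕ) (a : Fin r → ℕ) (i : Fin r) : Finset (Fin n) :=
  {j | blockStart τ a i ≤ j ∧ (j : ℕ) < blockStart τ a i + a i}

theorem blockStart_add_le {r : ℕ} (τ a : Fin r → ℕ) {i k : Fin r} (h : τ i < τ k) :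
    blockStart τ a i + a i ≤ blockStart τ a k := by
  unfold blockStart
  rw [add_comm, ← Finset.sum_insert (by simp)]
  refine Finset.sum_le_sum_of_subset fun l hl => ?_
  rcases Finset.mem_insert.1 hl with rfl | hl
  · simpa using h
  · simp only [Finset.mem_filter, Finset.mem_univ, true_and] at hl ⊢
    exact hl.trans h

theorem blockStart_add_le_sum {r : ℕ} (τ a : Fin r → ℕ) (i : Fin r) :
    blockStart τ a i + a i ≤ ∑ l, a l := by
  unfold blockStart
  rw [add_comm, ← Finset.sum_insert (by simp)]
  exact Finset.sum_le_sum_of_subset (Finset.subset_univ _)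

/-- The total size `n` ensures that no block is truncated by the end of `Fin n`. -/
theorem card_block {n r : ℕ} (τ a : Fin r → ℕ) (ha : ∑ l, a l = n) (i : Fin r) :
    (block n τ a i).card = a i := by
  have hle := blockStart_add_le_sum τ a i
  rw [ha] at hle
  have hmap : (block n τ a i).map Fin.valEmbedding
      = Finset.Ico (blockStart τ a i) (blockStart τ a i + a i) := by
    ext j
    simp only [block, Finset.mem_map, Finset.mem_filter, Finset.mem_univ, true_and,
      Fin.valEmbedding_apply, Finset.mem_Ico]
    constructor
    · rintro ⟨x, hx, rfl⟩
      exact hx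
    · intro hj
      exact ⟨⟨j, by omega⟩, hj, rfl⟩
  rw [← Finset.card_map Fin.valEmbedding, hmap, Nat.card_Ico]
  omega

theorem disjoint_block {n r : ℕ} {τ : Fin r → ℕ} (hτ : τ.Injective) (a : Fin r → ℕ)
    {i k : Fin r} (hik : i ≠ k) : Disjoint (block n τ a i) (block n τ a k) := by
  rw [Finset.disjoint_left]
  intro j hi hk
  simp only [block, Finset.mem_filter, Finset.mem_univ, true_and] at hi hk
  rcases lt_or_gt_of_ne (hτ.ne hik) with h | h
  · have := blockStart_add_le τ a h
    omega
  · have := blockStart_add_le τ a h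
    omega

/-- Two partitions of a finite type with the same part sizes differ by a permutation. -/
theorem exists_perm_image_eq {α ι : Type*} [Fintype α] [DecidableEq α] [Fintype ι]
    (B C : ι → Finset α) (hB : ∀ i k, i ≠ k → Disjoint (B i) (B k))
    (hC : ∀ i k, i ≠ k → Disjoint (C i) (C k)) (hcard : ∀ i, (B i).card = (C i).card)
    (hsum : ∑ i, (B i).card = Fintype.card α) :
    ∃ π : Equiv.Perm α, ∀ i, (B i).image π = C i := by
  -- Disjointness and the total cardinality force a cover, so the parts are the fibres of a
  -- colouring; `π` then glues bijections between fibres of equal size.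
  have key : ∀ B : ι → Finset α, (∀ i k, i ≠ k → Disjoint (B i) (B k)) →
      ∑ i, (B i).card = Fintype.card α → ∃ c : α → ι, ∀ x i, c x = i ↔ x ∈ B i := by
    intro B hB hsum
    have huniv : Finset.univ.biUnion B = Finset.univ := by
      rw [← Finset.card_eq_iff_eq_univ, Finset.card_biUnion fun i _ k _ h => hB i k h, hsum]
    have hex : ∀ x, ∃ i, x ∈ B i := fun x => by
      have : x ∈ Finset.univ.biUnion B := huniv ▸ Finset.mem_univ x
      simpa using this
    choose c hc using hex
    refine ⟨c, fun x i => ⟨fun h => h ▸ hc x, fun h => ?_⟩⟩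
    by_contra hne
    exact Finset.disjoint_left.1 (hB _ _ hne) (hc x) h
  obtain ⟨b, hb⟩ := key B hB hsum
  obtain ⟨c, hc⟩ := key C hC (by simpa only [hcard] using hsum)
  have e : ∀ i, Nonempty ({x // b x = i} ≃ {x // c x = i}) := fun i =>
    ⟨((Equiv.subtypeEquivRight fun x => hb x i).trans (Finset.equivOfCardEq (hcard i))).trans
      (Equiv.subtypeEquivRight fun x => hc x i).symm⟩
  let π := Equiv.ofFiberEquiv fun i => (e i).some
  have hπ : ∀ x, c (π x) = b x := Equiv.ofFiberEquiv_map _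
  refine ⟨π, fun i => Finset.eq_of_subset_of_card_le ?_ ?_⟩
  · intro y hy
    obtain ⟨x, hx, rfl⟩ := Finset.mem_image.1 hy
    rw [← hc, hπ, hb]
    exact hx
  · rw [Finset.card_image_of_injective _ π.injective, hcard]

theorem exists_perm_image_block {n r : ℕ} {τ τ' : Fin r → ℕ} (hτ : τ.Injective)
    (hτ' : τ'.Injective) (a : Fin r → ℕ) (ha : ∑ l, a l = n) :
    ∃ π : Equiv.Perm (Fin n), ∀ i, (block n τ a i).image π = block n τ' a i :=
  exists_perm_image_eq _ _ (fun _ _ => disjoint_block hτ a) (fun _ _ => disjoint_block hτ' a)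
    (fun i => by rw [card_block τ a ha, card_block τ' a ha])
    (by simp only [card_block τ a ha, ha, Fintype.card_fin])

/-! ### Coordinate subspaces of an orthonormal basis -/

/-- The subspace spanned by the images under `g` of the standard basis vectors in `B`. -/
def coordSpan {n : ℕ} (g : OrthGroup n) (B : Finset (Fin n)) : ModR n :=
  Submodule.span ℝ
    ((EuclideanSpace.basisFun (Fin n) ℝ).map (Unitary.linearIsometryEquiv g) '' B)

theorem coordSpan_mono {n : ℕ} (g : OrthGroup n) {B C : Finset (Fin n)} (h : B ⊆ C) :
    coordSpan g B ≤ coordSpan g C :=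
  Submodule.span_mono (image_mono (by exact_mod_cast h))

theorem finrank_coordSpan {n : ℕ} (g : OrthGroup n) (B : Finset (Fin n)) :
    Module.finrank ℝ (coordSpan g B) = B.card := by
  have h := ((EuclideanSpace.basisFun (Fin n) ℝ).map
    (Unitary.linearIsometryEquiv g)).orthonormal.linearIndependent.comp
      (fun j : B => j.1) Subtype.val_injective
  have h' := finrank_span_eq_card h
  have hrange : Set.range (fun j : B => j.1) = B := by
    ext
    simp
  rw [Set.range_comp, hrange, Fintype.card_coe] at h'
  exact h'

theorem coordSpan_isOrtho {n : ℕ} (g : OrthGroup n) {B C : Finset (Fin n)} (h : Disjoint B C) :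
    coordSpan g B ⟂ coordSpan g C := by
  refine Submodule.isOrtho_span.2 ?_
  rintro _ ⟨i, hi, rfl⟩ _ ⟨j, hj, rfl⟩
  refine ((EuclideanSpace.basisFun (Fin n) ℝ).map (Unitary.linearIsometryEquiv g)).orthonormal.2 ?_
  rintro rfl
  exact Finset.disjoint_left.1 h hi hj

theorem coordSpan_biUnion {n : ℕ} {ι : Type*} (g : OrthGroup n) (s : Finset ι)
    (B : ι → Finset (Fin n)) :
    coordSpan g (s.biUnion B) = ⨆ i ∈ s, coordSpan g (B i) := by
  simp only [coordSpan, Finset.coe_biUnion, Set.image_iUnion, Submodule.span_iUnion,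
    Finset.mem_coe]

theorem smul_stdFlag_apply {n : ℕ} (g : OrthGroup n) (k : Fin (n + 1)) :
    (g • stdFlag n).1 k = coordSpan g {j | (j : ℕ) < k} := by
  change ((stdFlag n).1 k).map _ = _
  rw [stdFlag, Submodule.map_span, ← Set.range_comp, coordSpan]
  congr 1
  ext x
  simp only [Set.mem_range, Set.mem_image, Finset.coe_filter, Finset.mem_univ, true_and,
    Set.mem_ofPred_eq, Subtype.exists]
  constructor
  · rintro ⟨j, hj, rfl⟩
    exact ⟨j, hj, by simp⟩
  · rintro ⟨j, hj, rfl⟩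
    exact ⟨j, hj, by simp⟩

/-- The orthogonal operator permuting the standard basis by `π`. -/
def permOp {n : ℕ} (π : Equiv.Perm (Fin n)) : OrthGroup n :=
  Unitary.linearIsometryEquiv.symm
    ((EuclideanSpace.basisFun (Fin n) ℝ).equiv (EuclideanSpace.basisFun (Fin n) ℝ) π)

/-- `g * permOp π` sends the `j`-th basis vector to the image under `g` of the `π j`-th: right
multiplication relabels the frame. -/
theorem coordSpan_mul_permOp {n : ℕ} (g : OrthGroup n) (π : Equiv.Perm (Fin n))
    (B : Finset (Fin n)) : coordSpan (g * permOp π) B = coordSpan g (B.image π) := by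
  have h : ∀ j, ((EuclideanSpace.basisFun (Fin n) ℝ).map
      (Unitary.linearIsometryEquiv (g * permOp π))) j
      = ((EuclideanSpace.basisFun (Fin n) ℝ).map (Unitary.linearIsometryEquiv g)) (π j) := by
    intro j
    rw [map_mul, permOp, MulEquiv.apply_symm_apply, OrthonormalBasis.map_apply,
      OrthonormalBasis.map_apply, LinearIsometryEquiv.coe_mul, Function.comp_apply,
      OrthonormalBasis.equiv_apply_basis]
  rw [coordSpan, coordSpan, Finset.coe_image, Set.image_image]
  congr 1
  exact Set.image_congr fun j _ => h j

/-! ### Decompositions and flags -/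

theorem isDecomposition_coordSpan {n r : ℕ} {τ : Fin r → ℕ} (hτ : τ.Injective) {a : Fin r → ℕ}
    (ha : a ∈ compositions n r) (g : OrthGroup n) :
    IsDecomposition fun i => coordSpan g (block n τ a i) := by
  simp only [compositions, Finset.mem_filter, Finset.mem_piAntidiag] at ha
  obtain ⟨⟨hsum, -⟩, hpos⟩ := ha
  have hortho : ∀ i j, i ≠ j → coordSpan g (block n τ a i) ⟂ coordSpan g (block n τ a j) :=
    fun i j h => coordSpan_isOrtho g (disjoint_block hτ a h)
  have huniv : Finset.univ.biUnion (block n τ a) = Finset.univ := by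
    rw [← Finset.card_eq_iff_eq_univ,
      Finset.card_biUnion fun i _ k _ h => disjoint_block hτ a h]
    simp only [card_block τ a hsum]
    rw [hsum, Fintype.card_fin]
  refine ⟨fun i h => ?_, hortho, ?_⟩
  · have h1 := finrank_coordSpan g (block n τ a i)
    rw [card_block τ a hsum] at h1
    have h2 : coordSpan g (block n τ a i) = ⊥ := h
    rw [h2, finrank_bot] at h1
    exact (hpos i).ne h1
  · refine (OrthogonalFamily.isInternal_iff
      (OrthogonalFamily.of_pairwise fun i j h => hortho i j h)).2 ?_
    have h1 := coordSpan_biUnion g Finset.univ (block n τ a)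
    rw [huniv] at h1
    simp only [Finset.mem_univ, iSup_pos] at h1
    rw [← h1, Submodule.orthogonal_eq_bot_iff]
    refine Submodule.eq_top_of_finrank_eq ?_
    rw [finrank_coordSpan]
    simp

/-- Orthogonal families with the same partial sums are equal. -/
theorem eq_of_iSup_Iic_eq {n r : ℕ} {D D' : Fin r → ModR n}
    (hD : ∀ i j, i ≠ j → D i ⟂ D j) (hD' : ∀ i j, i ≠ j → D' i ⟂ D' j)
    (h : ∀ i, ⨆ j ∈ Finset.Iic i, D j = ⨆ j ∈ Finset.Iic i, D' j) : D = D' := by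
  have split : ∀ (D : Fin r → ModR n) (i : Fin r),
      ⨆ j ∈ Finset.Iic i, D j = (⨆ j ∈ Finset.Iio i, D j) ⊔ D i := by
    intro D i
    rw [← Finset.Iio_insert, Finset.iSup_insert, sup_comm]
  -- By the modular law, `D i` is the orthogonal complement of the previous partial sum inside the
  -- current one.
  have cancel : ∀ (D : Fin r → ModR n), (∀ i j, i ≠ j → D i ⟂ D j) → ∀ i,
      D i = (⨆ j ∈ Finset.Iic i, D j) ⊓ (⨆ j ∈ Finset.Iio i, D j)ᗮ := by
    intro D hD i
    have hle : D i ≤ (⨆ j ∈ Finset.Iio i, D j)ᗮ := by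
      refine Submodule.IsOrtho.symm ?_
      rw [Submodule.isOrtho_iSup_left]
      intro j
      rw [Submodule.isOrtho_iSup_left]
      intro hj
      exact hD j i (Finset.mem_Iio.1 hj).ne
    rw [split, sup_comm, sup_inf_assoc_of_le _ hle, Submodule.inf_orthogonal_eq_bot, sup_bot_eq]
  funext i
  induction i using WellFoundedLT.induction with
  | ind i ih =>
    have hlt : ⨆ j ∈ Finset.Iio i, D j = ⨆ j ∈ Finset.Iio i, D' j :=
      iSup_congr fun j => iSup_congr fun hj => ih j (Finset.mem_Iio.1 hj)
    rw [cancel D hD, cancel D' hD', h, hlt]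

/-- In the natural order `Fin.val` the first blocks fill an initial segment, so their spans add up
to members of the flag. -/
theorem biUnion_block_Iic {n r : ℕ} (a : Fin r → ℕ) (ha : ∑ l, a l = n) (i : Fin r) :
    (Finset.Iic i).biUnion (block n Fin.val a)
      = ({j | (j : ℕ) < ∑ l ∈ Finset.Iic i, a l} : Finset (Fin n)) := by
  have hstart : ∀ l : Fin r, blockStart Fin.val a l + a l = ∑ j ∈ Finset.Iic l, a j := by
    intro l
    rw [← Finset.Iio_insert, Finset.sum_insert (by simp), add_comm, blockStart]
    congr 2
    ext
    simp
  refine Finset.eq_of_subset_of_card_le ?_ ?_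
  · intro j hj
    obtain ⟨l, hl, hj⟩ := Finset.mem_biUnion.1 hj
    simp only [block, Finset.mem_filter, Finset.mem_univ, true_and, hstart] at hj ⊢
    exact hj.2.trans_le (Finset.sum_le_sum_of_subset
      (Finset.Iic_subset_Iic.2 (Finset.mem_Iic.1 hl)))
  · rw [Finset.card_biUnion fun k _ l _ h => disjoint_block Fin.val_injective a h]
    simp only [card_block _ a ha]
    rw [Fin.card_filter_val_lt]
    exact min_le_right _ _

/-- The image under `g` of the standard flag is compatible with exactly one decomposition of a
given type, namely the one into coordinate subspaces of consecutive blocks. -/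
theorem smul_stdFlag_mem_flagsOf_iff {n r : ℕ} {𝒟 : Set (Fin r → ModR n)}
    (h𝒟 : 𝒟 ⊆ decompositions n r) {a : Fin r → ℕ} (ha : a ∈ compositions n r)
    (g : OrthGroup n) :
    g • stdFlag n ∈ flagsOf (ofType 𝒟 a) ↔
      (fun i => coordSpan g (block n Fin.val a i)) ∈ 𝒟 := by
  have hdec := isDecomposition_coordSpan Fin.val_injective ha g
  simp only [compositions, Finset.mem_filter, Finset.mem_piAntidiag] at ha
  obtain ⟨⟨hsum, -⟩, -⟩ := ha
  constructor
  · rintro ⟨D, ⟨hD, hdim⟩, hcomp⟩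
    suffices h : D = fun i => coordSpan g (block n Fin.val a i) by rwa [← h]
    refine eq_of_iSup_Iic_eq (h𝒟 hD).2.1 hdec.2.1 fun i => ?_
    obtain ⟨k, hk, hF⟩ := hcomp i
    simp only [hdim] at hk
    rw [← hF, smul_stdFlag_apply, ← coordSpan_biUnion, biUnion_block_Iic a hsum, hk]
  · intro hD
    have hdim : ∀ i, Module.finrank ℝ (coordSpan g (block n Fin.val a i)) = a i := fun i => by
      rw [finrank_coordSpan, card_block _ a hsum]
    refine ⟨_, ⟨hD, hdim⟩, fun i => ?_⟩
    have hle : ∑ l ∈ Finset.Iic i, a l ≤ n :=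
      (Finset.sum_le_sum_of_subset (Finset.subset_univ _)).trans hsum.le
    refine ⟨⟨∑ l ∈ Finset.Iic i, a l, Nat.lt_succ_of_le hle⟩, ?_, ?_⟩
    · simp only [hdim]
    · rw [smul_stdFlag_apply, ← coordSpan_biUnion, biUnion_block_Iic a hsum]

/-- In every coordinate system only few types of block decompositions belong to `𝒟`. -/
theorem card_types_le {n r : ℕ} {𝒟 : Set (Fin r → ModR n)} {t : Fin r → ℕ}
    (hfree : ∀ k, ChainFree (t k) (component 𝒟 k)) {τ : Fin r → ℕ}
    {m : Fin r} (hm : ∀ k, τ k ≤ τ m) (g : OrthGroup n) (S : Finset (Fin r → ℕ))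
    (hS : S ⊆ compositions n r)
    (hSD : ∀ a ∈ S, (fun i => coordSpan g (block n τ a i)) ∈ 𝒟) :
    S.card ≤ ∏ i ∈ Finset.univ.erase m, t i := by
  have hsum : ∀ a ∈ S, ∑ i, a i = n := fun a ha => by
    have := hS ha
    simp only [compositions, Finset.mem_filter, Finset.mem_piAntidiag] at this
    exact this.1.1
  refine card_le_prod_erase τ t S n hsum m hm fun k _ a ha => ?_
  by_contra! hlt
  set R := ({b ∈ S | ∀ l, τ l < τ k → b l = a l}) with hR
  classical
  set X := R.image fun b => coordSpan g (block n τ b k) with hX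
  have hchain : ∀ b ∈ R, ∀ c ∈ R, b k ≤ c k →
      coordSpan g (block n τ b k) ≤ coordSpan g (block n τ c k) := by
    intro b hb c hc hbc
    -- The start of block `k` depends only on the earlier sizes, which agree on `R`; hence the
    -- blocks are nested.
    have hs : ∀ b ∈ R, blockStart τ b k = blockStart τ a k := fun b hb =>
      Finset.sum_congr rfl fun l hl =>
        (Finset.mem_filter.1 hb).2 l (Finset.mem_filter.1 hl).2
    refine coordSpan_mono g fun j hj => ?_
    simp only [block, Finset.mem_filter, Finset.mem_univ, true_and, hs b hb, hs c hc] at hj ⊢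
    omega
  have hcard : t k + 1 ≤ X.card := by
    refine hlt.trans_le ?_
    -- Different sizes give subspaces of different dimensions, so `X` has at least as many members
    -- as there are sizes.
    have : R.image (fun b : Fin r → ℕ => b k) = X.image fun V : ModR n => Module.finrank ℝ V := by
      rw [hX, Finset.image_image]
      refine Finset.image_congr fun b hb => ?_
      rw [Function.comp_apply, finrank_coordSpan,
        card_block τ b (hsum b (Finset.mem_filter.1 hb).1)]
    refine le_of_eq_of_le ?_ ((congrArg Finset.card this).trans_le Finset.card_image_le)
    simp only [hR]
    congr!
  obtain ⟨C, hCX, hC⟩ := Finset.exists_subset_card_eq hcard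
  refine hfree k ⟨C, fun V hV => ?_, fun V hV W hW _ => ?_, hC⟩
  · obtain ⟨b, hb, rfl⟩ := Finset.mem_image.1 (hCX hV)
    exact ⟨_, hSD b (Finset.mem_filter.1 hb).1, rfl⟩
  · obtain ⟨b, hb, rfl⟩ := Finset.mem_image.1 (hCX hV)
    obtain ⟨c, hc, rfl⟩ := Finset.mem_image.1 (hCX hW)
    rcases le_total (b k) (c k) with h | h
    · exact Or.inl (hchain b hb c hc h)
    · exact Or.inr (hchain c hc b hb h)

/-! ### The Haar probability measure of the orthogonal group -/

/-- The Haar probability measure of `O(n)`. -/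
abbrev haarOrth (n : ℕ) : Measure (OrthGroup n) := Measure.haarMeasure ⊤

instance (n : ℕ) : IsProbabilityMeasure (haarOrth n) :=
  ⟨by simpa using Measure.haarMeasure_self (K₀ := (⊤ : TopologicalSpace.PositiveCompacts
    (OrthGroup n)))⟩

/-- A right translate of the left Haar probability is again one, and uniqueness identifies the two.
-/
instance (n : ℕ) : (haarOrth n).IsMulRightInvariant where
  map_mul_right_eq_self g := by
    have : IsProbabilityMeasure (Measure.map (· * g) (haarOrth n)) :=
      Measure.isProbabilityMeasure_map (measurable_mul_const g).aemeasurable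
    exact Measure.isHaarMeasure_eq_of_isProbabilityMeasure _ _

theorem bracketFactorial_pos (k : ℕ) : 0 < bracketFactorial k := by
  have homega : ∀ k, 0 < omega k := fun k =>
    ENNReal.toReal_pos (Metric.measure_ball_pos volume _ one_pos).ne' measure_ball_lt_top.ne
  refine Finset.prod_pos fun i hi => ?_
  have hi' : (0 : ℝ) < i := by exact_mod_cast (Finset.mem_Icc.1 hi).1
  exact div_pos (mul_pos hi' (homega i)) (mul_pos two_pos (homega _))

theorem aemeasurable_orbit (n : ℕ) :
    AEMeasurable (fun g : OrthGroup n => g • stdFlag n) (haarOrth n) :=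
  (continuous_orbit n).measurable.aemeasurable

/-- Scaling by the positive constant `[n]_ℝ!` does not change the null sets. -/
theorem nullMeasurableSet_map_orbit {n : ℕ} {A : Set (Flag n)}
    (hA : NullMeasurableSet A (flagMeasure n)) :
    NullMeasurableSet A (Measure.map (fun g : OrthGroup n => g • stdFlag n) (haarOrth n)) :=
  hA.mono_ac (Measure.absolutelyContinuous_smul
    (ENNReal.ofReal_pos.2 (bracketFactorial_pos n)).ne')

/-- The set of orthogonal operators whose coordinate decomposition, with consecutive blocks of
sizes `a` taken in the order given by `τ`, belongs to `𝒟`. -/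
def coordSet {n r : ℕ} (τ : Fin r → ℕ) (𝒟 : Set (Fin r → ModR n)) (a : Fin r → ℕ) :
    Set (OrthGroup n) :=
  {g | (fun i => coordSpan g (block n τ a i)) ∈ 𝒟}

section

variable {n r : ℕ} {𝒟 : Set (Fin r → ModR n)} {a : Fin r → ℕ}

theorem preimage_flagsOf_eq (h𝒟 : 𝒟 ⊆ decompositions n r) (ha : a ∈ compositions n r) :
    (fun g : OrthGroup n => g • stdFlag n) ⁻¹' flagsOf (ofType 𝒟 a) = coordSet Fin.val 𝒟 a :=
  Set.ext fun g => smul_stdFlag_mem_flagsOf_iff h𝒟 ha g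

theorem nullMeasurableSet_coordSet_val (h𝒟 : 𝒟 ⊆ decompositions n r)
    (hmeas : MeasurableFamily 𝒟) (ha : a ∈ compositions n r) :
    NullMeasurableSet (coordSet Fin.val 𝒟 a) (haarOrth n) := by
  rw [← preimage_flagsOf_eq h𝒟 ha]
  exact (nullMeasurableSet_map_orbit (hmeas a ha)).preimage
    ((continuous_orbit n).measurable.quasiMeasurePreserving _)

theorem nuType_eq (h𝒟 : 𝒟 ⊆ decompositions n r)
    (hmeas : MeasurableFamily 𝒟) (ha : a ∈ compositions n r) :
    nuType n a (ofType 𝒟 a) = ENNReal.ofReal (bracketFactorial n) *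
      haarOrth n (coordSet Fin.val 𝒟 a) / ENNReal.ofReal (∏ i, bracketFactorial (a i)) := by
  rw [nuType, flagMeasure, Measure.smul_apply, smul_eq_mul,
    Measure.map_apply₀ (aemeasurable_orbit n) (nullMeasurableSet_map_orbit (hmeas a ha)),
    preimage_flagsOf_eq h𝒟 ha]

theorem multiflag_eq (ha : a ∈ compositions n r) :
    multiflag n a = ENNReal.ofReal (bracketFactorial n) /
      ENNReal.ofReal (∏ i, bracketFactorial (a i)) := by
  have hcoord : coordSet Fin.val (decompositions n r) a = univ :=
    Set.eq_univ_of_forall fun g => isDecomposition_coordSpan Fin.val_injective ha g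
  have hone : Measure.map (fun g : OrthGroup n => g • stdFlag n) (haarOrth n)
      (flagsOf (ofType (decompositions n r) a)) = 1 := by
    have := Measure.isProbabilityMeasure_map (aemeasurable_orbit n)
    refine le_antisymm prob_le_one ?_
    -- This inequality holds for arbitrary sets, so measurability of the set of flags need not be
    -- known.
    have h := Measure.le_map_apply (aemeasurable_orbit n)
      (flagsOf (ofType (decompositions n r) a))
    rwa [preimage_flagsOf_eq subset_rfl ha, hcoord, measure_univ] at h
  rw [multiflag, nuType, flagMeasure, Measure.smul_apply, hone, smul_eq_mul, mul_one]

theorem nuType_eq_mul_multiflag (h𝒟 : 𝒟 ⊆ decompositions n r)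
    (hmeas : MeasurableFamily 𝒟) (ha : a ∈ compositions n r) :
    nuType n a (ofType 𝒟 a) = haarOrth n (coordSet Fin.val 𝒟 a) * multiflag n a := by
  rw [nuType_eq h𝒟 hmeas ha, multiflag_eq ha, mul_comm (ENNReal.ofReal _), mul_div_assoc]

theorem nuType_div_multiflag (h𝒟 : 𝒟 ⊆ decompositions n r)
    (hmeas : MeasurableFamily 𝒟) (ha : a ∈ compositions n r) :
    nuType n a (ofType 𝒟 a) / multiflag n a = haarOrth n (coordSet Fin.val 𝒟 a) := by
  rw [nuType_eq_mul_multiflag h𝒟 hmeas ha]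
  refine ENNReal.mul_div_cancel_right ?_ ?_ <;> rw [multiflag_eq ha]
  · exact (ENNReal.div_pos (ENNReal.ofReal_pos.2 (bracketFactorial_pos n)).ne'
      ENNReal.ofReal_ne_top).ne'
  · exact ENNReal.div_ne_top ENNReal.ofReal_ne_top
      (ENNReal.ofReal_pos.2 (Finset.prod_pos fun i _ => bracketFactorial_pos _)).ne'

/-- Reordering the blocks amounts to a right translation of `O(n)`. -/
theorem exists_preimage_mul_right_eq_coordSet {τ τ' : Fin r → ℕ} (hτ : τ.Injective)
    (hτ' : τ'.Injective) (𝒟 : Set (Fin r → ModR n)) (ha : a ∈ compositions n r) :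
    ∃ w : OrthGroup n, (fun g => g * w) ⁻¹' coordSet τ 𝒟 a = coordSet τ' 𝒟 a := by
  simp only [compositions, Finset.mem_filter, Finset.mem_piAntidiag] at ha
  obtain ⟨π, hπ⟩ := exists_perm_image_block hτ hτ' a ha.1.1
  refine ⟨permOp π, ?_⟩
  ext g
  simp only [coordSet, Set.mem_preimage, Set.mem_ofPred_eq, coordSpan_mul_permOp, hπ]

/-- The normalized sizes of the parts of `𝒟` add up to at most `∏ t` over all indices but one. -/
theorem sum_haarOrth_coordSet_le {t : Fin r → ℕ} (h𝒟 : 𝒟 ⊆ decompositions n r)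
    (hmeas : MeasurableFamily 𝒟) (hfree : ∀ k, ChainFree (t k) (component 𝒟 k)) (m : Fin r) :
    ∑ a ∈ compositions n r, haarOrth n (coordSet Fin.val 𝒟 a)
      ≤ ((∏ i ∈ Finset.univ.erase m, t i : ℕ) : ℝ≥0∞) := by
  classical
  -- The natural order with `m` moved to the end: the value `r` exceeds every index in `Fin r`.
  set τ : Fin r → ℕ := fun i => if i = m then r else i with hτdef
  have hτ : τ.Injective := by
    intro i j hij
    simp only [hτdef] at hij
    split_ifs at hij <;> first | (subst_vars; rfl) | omega
  have hm : ∀ k, τ k ≤ τ m := by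
    intro k
    simp only [hτdef]
    split_ifs <;> omega
  have hmeas' : ∀ a ∈ compositions n r, NullMeasurableSet (coordSet τ 𝒟 a) (haarOrth n) ∧
      haarOrth n (coordSet τ 𝒟 a) = haarOrth n (coordSet Fin.val 𝒟 a) := by
    intro a ha
    obtain ⟨w, hw⟩ := exists_preimage_mul_right_eq_coordSet Fin.val_injective hτ 𝒟 ha
    rw [← hw]
    exact ⟨(nullMeasurableSet_coordSet_val h𝒟 hmeas ha).preimage
      (measurePreserving_mul_right (haarOrth n) w).quasiMeasurePreserving,
      measure_preimage_mul_right _ _ _⟩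
  calc ∑ a ∈ compositions n r, haarOrth n (coordSet Fin.val 𝒟 a)
      = ∑ a ∈ compositions n r, ∫⁻ g, (coordSet τ 𝒟 a).indicator 1 g ∂haarOrth n := by
        refine Finset.sum_congr rfl fun a ha => ?_
        rw [lintegral_indicator_one₀ (hmeas' a ha).1, (hmeas' a ha).2]
    _ = ∫⁻ g, ∑ a ∈ compositions n r, (coordSet τ 𝒟 a).indicator 1 g ∂haarOrth n := by
        refine (lintegral_finsetSum' _ fun a ha => ?_).symm
        exact aemeasurable_one.indicator₀ (hmeas' a ha).1
    _ ≤ ∫⁻ _, ((∏ i ∈ Finset.univ.erase m, t i : ℕ) : ℝ≥0∞) ∂haarOrth n := by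
        -- The integrand counts the types caught in the frame `g`, so the deterministic bound
        -- applies pointwise.
        refine lintegral_mono fun g => ?_
        have h := card_types_le hfree hm g {a ∈ compositions n r | g ∈ coordSet τ 𝒟 a}
          (Finset.filter_subset _ _) (fun a ha => (Finset.mem_filter.1 ha).2)
        simp only [Set.indicator_apply, Pi.one_apply, Finset.sum_boole]
        exact_mod_cast h
    _ = _ := by simp

end

theorem prod_div_sup_eq_prod_erase {ι : Type*} [DecidableEq ι] (s : Finset ι) (t : ι → ℕ)
    {m : ι} (hm : m ∈ s) (hpos : 0 < t m) (hmax : ∀ i ∈ s, t i ≤ t m) :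
    (∏ i ∈ s, t i) / s.sup t = ∏ i ∈ s.erase m, t i := by
  rw [le_antisymm (Finset.sup_le hmax) (Finset.le_sup hm), ← Finset.mul_prod_erase s t hm,
    Nat.mul_div_cancel_left _ hpos]

end ContinuousLYM
end

open ContinuousLYM
theorem theorem5 (n r : ℕ) (hr : 0 < r) (t : Fin r → ℕ) (ht : ∀ i, 0 < t i)
    (σ : ℕ) (hσ : σ = (∏ i, t i) / Finset.univ.sup t)
    (𝒟 : Set (Fin r → ModR n)) (h𝒟 : 𝒟 ⊆ decompositions n r)
    (hmeas : MeasurableFamily 𝒟)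
    (hfree : ∀ k : Fin r, ChainFree (t k) (component 𝒟 k)) :
    (∑ a ∈ compositions n r, nuType n a (ofType 𝒟 a) / multiflag n a ≤ (σ : ENNReal)) ∧
      nu n r 𝒟 ≤
        sumLargest ((compositions n r).val.map fun a => multiflag n a) σ := by
  -- Omitting the index with the largest `t` gives the smallest product; the natural-number division
  -- defining `σ` is then exact.
  obtain ⟨m, -, hmax⟩ := Finset.exists_max_image Finset.univ t ⟨⟨0, hr⟩, Finset.mem_univ _⟩
  rw [prod_div_sup_eq_prod_erase _ t (Finset.mem_univ m) (ht m) hmax] at hσ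
  have hsum := sum_haarOrth_coordSet_le h𝒟 hmeas hfree m
  rw [← hσ] at hsum
  constructor
  · rwa [Finset.sum_congr rfl fun a ha => nuType_div_multiflag h𝒟 hmeas ha]
  · rw [nu, Finset.sum_congr rfl fun a ha => nuType_eq_mul_multiflag h𝒟 hmeas ha]
    exact sum_mul_le_sumLargest _ _ _ _ (fun _ _ => prob_le_one) hsum
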